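/- Let $N\ge 1$, let $\Omega=(a_1,b_1)\times\cdots\times(a_N,b_N)\subset\mathbb R^N$ with $a_i<b_i$, let $m_i\ge 4$ be integers, and put $h_i=\frac{b_i-a_i}{m_i-1}$, $h^*=\max_i h_i$. For each multi-index $\alpha$ with integer entries $1\le\alpha_i\le m_i$ let $x_\alpha$ be the grid point with coordinates $a_i+(\alpha_i-1)h_i$, and let $\mathcal T_h$ be the set of all these grid points. Let $\widetilde{\partial\Omega}$ be the smooth part of $\partial\Omega$ (the boundary points with exactly one coordinate at an end point $a_i$ or $b_i$), with outward unit normal $\widehat n$. For $u:\mathcal T_h\to\mathbb R$ let $$\delta_i^{+}u(x_\alpha)=\frac{u(x_{\alpha+e_i})-u(x_\alpha)}{h_i},\qquad \delta_i^-u(x_\alpha)=\frac{u(x_\alpha)-u(x_{\alpha-e_i})}{h_i},\qquad \delta_i=\tfrac12(\delta_i^++\delta_i^-),$$ $$\Delta_hu(x_\alpha)=\sum_{i=1}^N\frac{u(x_{\alpha+e_i})-2u(x_\alpha)+u(x_{\alpha-e_i})}{h_i^2},$$ and, for $x_\alpha\in\widetilde{\partial\Omega}$, let $\nabla_h^*u(x_\alpha)\cdot\widehat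 n(x_\alpha)=\sum_{i=1}^N[\nabla^*_hu(x_\alpha)]_i\,\widehat n_i(x_\alpha)$, where $[\nabla_h^*u(x_\alpha)]_i$ is $\delta_i^+u(x_\alpha)$ if $\widehat n_i(x_\alpha)<0$, $\delta_i^-u(x_\alpha)$ if $\widehat n_i(x_\alpha)>0$, and $\delta_iu(x_\alpha)$ if $\widehat n_i(x_\alpha)=0$. Let $f:[0,\infty)\to[0,\infty)$ be continuous, let $\lambda>0$, and let $\rho,K>0$ with $\rho\le\frac{K}{h^*}$. Define $\widetilde f:[0,\infty)\to\left[\frac{\rho}{\lambda},\frac{K}{\lambda h^*}\right]$ by $$\widetilde f(s)=\begin{cases}\frac{K}{\lambda h^*}&\text{if } f(s)>\frac{K}{\lambda h^*},\\[2pt] \frac{\rho}{\lambda}&\text{if } f(s)<\frac{\rho}{\lambda},\\[2pt] f(s)&\text{otherwise.}\end{cases}$$ Then there exists a nonnegative grid function $\widetilde u_h:\mathcal T_h\to\mathbb R$ such that $$\begin{cases}-\Delta_h\widetilde u_h+\widetilde u_h=0&\text{in }\mathcal T_h\cap\Omega,\\ \nabla_h^*\widetilde u_h\cdot\widehat n-\lambda\widetilde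 f(\widetilde u_h)=0&\text{on }\mathcal T_h\cap\widetilde{\partial\Omega}.\end{cases}$$ -/

import Mathlib

open Set

noncomputable section

namespace RectFD

variable {N : ℕ}

/-- The open `N`-rectangle `Ω = (a₁, b₁) × ⋯ × (a_N, b_N)`. -/
def domain (a b : Fin N → ℝ) : Set (Fin N → ℝ) :=
  {x | ∀ i, a i < x i ∧ x i < b i}

/-- The points at which the boundary of the `N`-rectangle is smooth, i.e. the relative interiors of
the faces of dimension `N - 1`: the boundary points with exactly one coordinate at an end point. -/
def smoothBoundary (a b : Fin N → ℝ) : Set (Fin N → ℝ) :=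
  {x | x ∈ frontier (domain a b) ∧ ∃! i, x i = a i ∨ x i = b i}

/-- The outward unit normal `n̂(x)` at a smooth boundary point `x` of the `N`-rectangle. -/
def outwardNormal (a b : Fin N → ℝ) (x : Fin N → ℝ) : Fin N → ℝ :=
  fun i => if x i = a i then -1 else if x i = b i then 1 else 0

/-- The mesh sizes `hᵢ = (bᵢ - aᵢ) / (mᵢ - 1)`. -/
def step (a b : Fin N → ℝ) (m : Fin N → ℕ) (i : Fin N) : ℝ :=
  (b i - a i) / ((m i : ℝ) - 1)

/-- The largest mesh size `h^* = maxᵢ hᵢ`. -/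
def maxStep (a b : Fin N → ℝ) (m : Fin N → ℕ) : ℝ :=
  ⨆ i, step a b m i

/-- The multi-indices `α = (α₁, …, α_N)` with `1 ≤ αᵢ ≤ mᵢ`. -/
def indexSet (m : Fin N → ℕ) : Set (Fin N → ℤ) :=
  {α | ∀ i, 1 ≤ α i ∧ α i ≤ (m i : ℤ)}

/-- The grid point `x_α`, with coordinates `aᵢ + (αᵢ - 1) hᵢ`. -/
def gridPoint (a b : Fin N → ℝ) (m : Fin N → ℕ) (α : Fin N → ℤ) : Fin N → ℝ :=
  fun i => a i + ((α i : ℝ) - 1) * step a b m i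

/-- A grid function `u_h : 𝒯_h → ℝ`, where the node `x_α` is named by its multi-index `α`. -/
abbrev GridFunction (m : Fin N → ℕ) : Type :=
  indexSet m → ℝ

open Classical in
/-- The value `u_h(x_α)`. Off the grid it is `0`, but such values are not used at the nodes at which
the difference operators below are evaluated. -/
def GridFunction.val {m : Fin N → ℕ} (u : GridFunction m) (α : Fin N → ℤ) : ℝ :=
  if hα : α ∈ indexSet m then u ⟨α, hα⟩ else 0

/-- The forward difference `δ⁺` in the direction `i`. -/
def forwardDiff (a b : Fin N → ℝ) {m : Fin N → ℕ} (u : GridFunction m) (i : Fin N)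
    (α : Fin N → ℤ) : ℝ :=
  (u.val (α + Pi.single i 1) - u.val α) / step a b m i

/-- The backward difference `δ⁻` in the direction `i`. -/
def backwardDiff (a b : Fin N → ℝ) {m : Fin N → ℕ} (u : GridFunction m) (i : Fin N)
    (α : Fin N → ℤ) : ℝ :=
  (u.val α - u.val (α - Pi.single i 1)) / step a b m i

/-- The central difference `δ` in the direction `i`. -/
def centralDiff (a b : Fin N → ℝ) {m : Fin N → ℕ} (u : GridFunction m) (i : Fin N)
    (α : Fin N → ℤ) : ℝ :=
  (1 / 2) * forwardDiff a b u i α + (1 / 2) * backwardDiff a b u i α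

/-- The second central difference `δ²` in the direction `i`. -/
def secondDiff (a b : Fin N → ℝ) {m : Fin N → ℕ} (u : GridFunction m) (i : Fin N)
    (α : Fin N → ℤ) : ℝ :=
  (u.val (α + Pi.single i 1) - 2 * u.val α + u.val (α - Pi.single i 1)) / step a b m i ^ 2

/-- The discrete Laplacian `Δ_h u_h (x_α)`. -/
def discreteLaplacian (a b : Fin N → ℝ) {m : Fin N → ℕ} (u : GridFunction m)
    (α : Fin N → ℤ) : ℝ :=
  ∑ i, secondDiff a b u i α

/-- The `i`-th component of the discrete gradient `∇^*_h u_h (x_α)`, in which the difference quotient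
is chosen by the sign of the `i`-th component of the outward normal. -/
def boundaryGradient (a b : Fin N → ℝ) {m : Fin N → ℕ} (u : GridFunction m)
    (α : Fin N → ℤ) (i : Fin N) : ℝ :=
  if outwardNormal a b (gridPoint a b m α) i < 0 then forwardDiff a b u i α
  else if 0 < outwardNormal a b (gridPoint a b m α) i then backwardDiff a b u i α
  else centralDiff a b u i α

/-- The discrete outward normal derivative `∇^*_h u_h (x_α) · n̂(x_α)`. -/
def normalDeriv (a b : Fin N → ℝ) {m : Fin N → ℕ} (u : GridFunction m)
    (α : Fin N → ℤ) : ℝ :=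
  ∑ i, boundaryGradient a b u α i * outwardNormal a b (gridPoint a b m α) i

/-- The cutoff `f̃` of `f`, from below at `ρ / λ` and from above at `K / (λ H)`. -/
def cutoff (f : ℝ → ℝ) (lam ρ K H : ℝ) (s : ℝ) : ℝ :=
  if K / (lam * H) < f s then K / (lam * H)
  else if f s < ρ / lam then ρ / lam
  else f s

/-- The grid function `u` solves the finite difference scheme `-Δ_h u + u = 0` at the nodes in `Ω`
and `∇^*_h u · n̂ - λ g(u) = 0` at the nodes on the smooth part of the boundary. -/
def SolvesScheme (a b : Fin N → ℝ) (m : Fin N → ℕ) (lam : ℝ) (g : ℝ → ℝ)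
    (u : GridFunction m) : Prop :=
  (∀ α ∈ indexSet m, gridPoint a b m α ∈ domain a b →
    -discreteLaplacian a b u α + u.val α = 0) ∧
  (∀ α ∈ indexSet m, gridPoint a b m α ∈ smoothBoundary a b →
    normalDeriv a b u α - lam * g (u.val α) = 0)

end RectFD

end

/-!
The scheme is the Euler-Lagrange equation of a discrete energy. Divide the boundary equation at a
node on the face orthogonal to the `i`-th axis by `hᵢ`: only the difference in the normal direction
survives in `∇^*_h u · n̂`, and the edge to the inner neighbour gets the coefficient `1 / hᵢ²`, the
same as in the discrete Laplacian at that neighbour. So the system reads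

  `∑ β, w α β (u α - u β) + κ α u α = c α g(u α)`

with symmetric weights `w ≥ 0` (`RectFD.weight`), with `κ = 0` on the smooth boundary and `κ = 1`
elsewhere, and with `c = λ / hᵢ` on the smooth boundary and `c = 0` inside. Here `g` is the cutoff
of `f`, extended to the negative reals by its value at `0`, hence continuous, bounded and
nonnegative. The equations are the critical point equations of

  `E(u) = 1/4 ∑ w α β (u α - u β)² + 1/2 ∑ κ α (u α)² - ∑ c α G(u α)`,  `G' = g`.

The quadratic part is coercive because every node has `κ > 0` or a neighbour with `κ > 0`
(`WeightedGraph.exists_coercive`), and `G` grows at most linearly, so `E` has a minimum and the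
system has a solution (`WeightedGraph.exists_solution`). As the right-hand side is nonnegative, the
discrete maximum principle (`WeightedGraph.nonneg_of_supersolution`) gives `u ≥ 0`, where `g` is the
cutoff itself.

A node on two or more faces is subject to no equation of the scheme and is no neighbour of an
interior node; the equation imposed on it above is decoupled from the rest.
-/

/-! ### Semilinear equations on finite weighted graphs -/

open Finset in
/-- The energy is positive definite: if it vanishes, then `u` vanishes where `κ` is positive, and
`u` takes the same value at the two ends of an edge of positive weight. Homogeneity and compactness
of the unit sphere make this quantitative. -/
theorem WeightedGraph.exists_coercive {V : Type*} [Fintype V] (w : V → V → ℝ) (κ : V → ℝ)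
    (hw : ∀ x y, 0 ≤ w x y) (hκ : ∀ x, 0 ≤ κ x)
    (hpos : ∀ x, 0 < κ x ∨ ∃ y, 0 < w x y ∧ 0 < κ y) :
    ∃ c > 0, ∀ u : V → ℝ, c * ‖u‖ ^ 2 ≤
      1 / 4 * ∑ x, ∑ y, w x y * (u x - u y) ^ 2 + 1 / 2 * ∑ x, κ x * u x ^ 2 := by
  set Q : (V → ℝ) → ℝ := fun u =>
    1 / 4 * ∑ x, ∑ y, w x y * (u x - u y) ^ 2 + 1 / 2 * ∑ x, κ x * u x ^ 2 with hQ
  have hQc : Continuous Q := by fun_prop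
  have hterm1 : ∀ (u : V → ℝ) x y, 0 ≤ w x y * (u x - u y) ^ 2 := fun u x y =>
    mul_nonneg (hw x y) (sq_nonneg _)
  have hterm2 : ∀ (u : V → ℝ) x, 0 ≤ κ x * u x ^ 2 := fun u x => mul_nonneg (hκ x) (sq_nonneg _)
  have hsum1 : ∀ u : V → ℝ, 0 ≤ ∑ x, ∑ y, w x y * (u x - u y) ^ 2 := fun u =>
    sum_nonneg fun x _ => sum_nonneg fun y _ => hterm1 u x y
  have hsum2 : ∀ u : V → ℝ, 0 ≤ ∑ x, κ x * u x ^ 2 := fun u => sum_nonneg fun x _ => hterm2 u x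
  have hQ0 : ∀ u, Q u ≤ 0 → u = 0 := by
    intro u hu
    have e1 : ∑ x, ∑ y, w x y * (u x - u y) ^ 2 = 0 := by
      have := hsum1 u; have := hsum2 u; simp only [hQ] at hu; linarith
    have e2 : ∑ x, κ x * u x ^ 2 = 0 := by
      have := hsum1 u; have := hsum2 u; simp only [hQ] at hu; linarith
    rw [sum_eq_zero_iff_of_nonneg fun x _ => hterm2 u x] at e2
    rw [sum_eq_zero_iff_of_nonneg fun x _ => sum_nonneg fun y _ => hterm1 u x y] at e1
    have h2 : ∀ x, 0 < κ x → u x = 0 := by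
      intro x hx
      have := e2 x (mem_univ x)
      simpa [hx.ne'] using this
    ext x
    rcases hpos x with hx | ⟨y, hxy, hy⟩
    · exact h2 x hx
    · have h1 := e1 x (mem_univ x)
      rw [sum_eq_zero_iff_of_nonneg fun y _ => hterm1 u x y] at h1
      have h3 := h1 y (mem_univ y)
      simpa [hxy.ne', h2 y hy] using h3
  rcases (Metric.sphere (0 : V → ℝ) 1).eq_empty_or_nonempty with he | hne
  · refine ⟨1, one_pos, fun u => ?_⟩
    have hu : u = 0 := by
      by_contra hu
      have : (‖u‖⁻¹ • u) ∈ Metric.sphere (0 : V → ℝ) 1 := by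
        simp [norm_smul, inv_mul_cancel₀ (norm_ne_zero_iff.mpr hu)]
      simp [he] at this
    simp [hu]
  · obtain ⟨v, hv, hmin⟩ := (isCompact_sphere (0 : V → ℝ) 1).exists_isMinOn hne hQc.continuousOn
    refine ⟨Q v, ?_, fun u => ?_⟩
    · by_contra hlt
      have := hQ0 v (not_lt.mp hlt)
      simp [this] at hv
    · change Q v * ‖u‖ ^ 2 ≤ Q u
      by_cases hu : u = 0
      · simp [hu, hQ]
      have hn : ‖u‖ ≠ 0 := norm_ne_zero_iff.mpr hu
      have hmem : (‖u‖⁻¹ • u) ∈ Metric.sphere (0 : V → ℝ) 1 := by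
        simp [norm_smul, inv_mul_cancel₀ hn]
      have hle : Q v ≤ Q (‖u‖⁻¹ • u) := hmin hmem
      have hscale : Q (‖u‖⁻¹ • u) * ‖u‖ ^ 2 = Q u := by
        simp only [hQ, Pi.smul_apply, smul_eq_mul, add_mul, mul_assoc, sum_mul]
        congr 2
        · refine sum_congr rfl fun x _ => sum_congr rfl fun y _ => ?_
          field_simp
        · refine sum_congr rfl fun x _ => ?_
          field_simp
      rw [← hscale]
      gcongr

open Finset in
/-- A semilinear equation with bounded continuous nonlinearity, solved by minimising its energy. -/
theorem WeightedGraph.exists_solution {V : Type*} [Fintype V] (w : V → V → ℝ) (κ c : V → ℝ)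
    (hsymm : ∀ x y, w x y = w y x) (hw : ∀ x y, 0 ≤ w x y) (hκ : ∀ x, 0 ≤ κ x)
    (hpos : ∀ x, 0 < κ x ∨ ∃ y, 0 < w x y ∧ 0 < κ y)
    (g : ℝ → ℝ) (hg : Continuous g) (M : ℝ) (hM : ∀ s, |g s| ≤ M) :
    ∃ u : V → ℝ, ∀ x, ∑ y, w x y * (u x - u y) + κ x * u x = c x * g (u x) := by
  classical
  obtain ⟨C, hC, hcoer⟩ := exists_coercive w κ hw hκ hpos
  set G : ℝ → ℝ := fun s => ∫ t in (0 : ℝ)..s, g t with hG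
  have hGd : ∀ s, HasDerivAt G (g s) s := fun s =>
    intervalIntegral.integral_hasDerivAt_right (hg.intervalIntegrable _ _)
      (hg.stronglyMeasurableAtFilter _ _) hg.continuousAt
  have hGc : Continuous G := continuous_iff_continuousAt.mpr fun s => (hGd s).continuousAt
  have hGb : ∀ s, |G s| ≤ M * |s| := by
    intro s
    have := intervalIntegral.norm_integral_le_of_norm_le_const (a := 0) (b := s) (f := g) (C := M)
      (fun t _ => hM t)
    simpa [hG] using this
  have hM0 : 0 ≤ M := (abs_nonneg _).trans (hM 0)
  set E : (V → ℝ) → ℝ := fun u =>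
    1 / 4 * ∑ x, ∑ y, w x y * (u x - u y) ^ 2 + 1 / 2 * ∑ x, κ x * u x ^ 2
      - ∑ x, c x * G (u x) with hE
  have hEc : Continuous E := by fun_prop
  set D : ℝ := (∑ x, |c x|) * M with hD
  have hD0 : 0 ≤ D := by positivity
  have hlin : ∀ u : V → ℝ, ∑ x, c x * G (u x) ≤ D * ‖u‖ := by
    intro u
    rw [hD, sum_mul, sum_mul]
    refine sum_le_sum fun x _ => ?_
    calc c x * G (u x) ≤ |c x| * |G (u x)| := by rw [← abs_mul]; exact le_abs_self _
      _ ≤ |c x| * (M * ‖u‖) := by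
        gcongr
        exact (hGb _).trans (by gcongr; exact norm_le_pi_norm u x)
      _ = _ := by ring
  -- Outside this ball coercivity beats the linear growth, so that `E ≥ 0 = E 0` there.
  obtain ⟨u, -, hmin⟩ := (isCompact_closedBall (0 : V → ℝ) (D / C)).exists_isMinOn
    ⟨0, by simp; positivity⟩ hEc.continuousOn
  have hglob : ∀ v, E u ≤ E v := by
    intro v
    by_cases hv : v ∈ Metric.closedBall (0 : V → ℝ) (D / C)
    · exact hmin hv
    · have h0 : E u ≤ E 0 := hmin (by simp; positivity)
      have hE0 : E 0 = 0 := by simp [hE, hG]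
      have hv' : D < ‖v‖ * C := by
        simpa [div_lt_iff₀ hC] using hv
      have h1 := hcoer v
      have h2 := hlin v
      have h3 : D * ‖v‖ ≤ C * ‖v‖ ^ 2 := by nlinarith [norm_nonneg v]
      have : 0 ≤ E v := by simp only [hE]; linarith
      linarith
  refine ⟨u, fun z => ?_⟩
  set δ : V → ℝ := Pi.single z 1 with hδ
  have hderiv : HasDerivAt (fun t : ℝ => E (fun x => u x + t * δ x))
      (1 / 4 * ∑ x, ∑ y, w x y * (2 * (u x - u y) * (δ x - δ y))
        + 1 / 2 * ∑ x, κ x * (2 * u x * δ x) - ∑ x, c x * (g (u x) * δ x)) 0 := by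
    have hu : ∀ x, HasDerivAt (fun t : ℝ => u x + t * δ x) (δ x) 0 := fun x => by
      simpa using ((hasDerivAt_id (0 : ℝ)).mul_const (δ x)).const_add (u x)
    refine ((HasDerivAt.const_mul _ (HasDerivAt.fun_sum fun x _ => HasDerivAt.fun_sum fun y _ =>
      HasDerivAt.const_mul _ ?_)).add (HasDerivAt.const_mul _ (HasDerivAt.fun_sum fun x _ =>
      HasDerivAt.const_mul _ ?_))).sub (HasDerivAt.fun_sum fun x _ => HasDerivAt.const_mul _ ?_)
    · simpa using ((hu x).fun_sub (hu y)).fun_pow 2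
    · simpa using (hu x).fun_pow 2
    · have h := hGd (u x + 0 * δ x)
      simpa [Function.comp_def] using h.comp (0 : ℝ) (hu x)
  have hcrit := IsLocalMin.hasDerivAt_eq_zero (f := fun t : ℝ => E (fun x => u x + t * δ x))
    (Filter.Eventually.of_forall fun t => by simpa using hglob _) hderiv
  have hδs : ∀ φ : V → ℝ, ∑ x, φ x * δ x = φ z := fun φ => by
    simp [hδ, Pi.single_apply]
  -- By symmetry of `w`, each edge at `z` is counted twice.
  have e1 : ∑ x, ∑ y, w x y * (2 * (u x - u y) * (δ x - δ y))
      = 4 * ∑ y, w z y * (u z - u y) := by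
    have s1 : ∑ x, ∑ y, w x y * (u x - u y) * δ x = ∑ y, w z y * (u z - u y) := by
      simp_rw [← sum_mul]
      exact hδs fun x => ∑ y, w x y * (u x - u y)
    have s2 : ∑ x, ∑ y, w x y * (u x - u y) * δ y = - ∑ y, w z y * (u z - u y) := by
      rw [sum_comm, ← s1, ← sum_neg_distrib]
      refine sum_congr rfl fun x _ => ?_
      rw [← sum_neg_distrib]
      refine sum_congr rfl fun y _ => ?_
      rw [hsymm y x]; ring
    calc _ = 2 * (∑ x, ∑ y, w x y * (u x - u y) * δ x)
          - 2 * ∑ x, ∑ y, w x y * (u x - u y) * δ y := by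
          simp_rw [mul_sum, ← sum_sub_distrib]
          exact sum_congr rfl fun x _ => sum_congr rfl fun y _ => by ring
      _ = _ := by rw [s1, s2]; ring
  have e2 : ∑ x, κ x * (2 * u x * δ x) = 2 * (κ z * u z) := by
    rw [← hδs fun x => κ x * u x, mul_sum]
    exact sum_congr rfl fun x _ => by ring
  have e3 : ∑ x, c x * (g (u x) * δ x) = c z * g (u z) := by
    rw [← hδs fun x => c x * g (u x)]
    exact sum_congr rfl fun x _ => by ring
  rw [e1, e2, e3] at hcrit
  linarith

open Finset in
/-- Discrete maximum principle. -/
theorem WeightedGraph.nonneg_of_supersolution {V : Type*} [Fintype V] (w : V → V → ℝ) (κ : V → ℝ)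
    (hw : ∀ x y, 0 ≤ w x y) (hκ : ∀ x, 0 ≤ κ x)
    (hpos : ∀ x, 0 < κ x ∨ ∃ y, 0 < w x y ∧ 0 < κ y) (u : V → ℝ)
    (hu : ∀ x, 0 ≤ ∑ y, w x y * (u x - u y) + κ x * u x) (x : V) : 0 ≤ u x := by
  have : Nonempty V := ⟨x⟩
  obtain ⟨z, hz⟩ := Finite.exists_min u
  refine le_trans ?_ (hz x)
  by_contra! hneg
  -- A node with the negative minimal value carries no mass, by the inequality there.
  have key : ∀ y, u y = u z → κ y ≤ 0 := by
    intro y hy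
    have h1 : ∑ y', w y y' * (u y - u y') ≤ 0 := sum_nonpos fun y' _ =>
      mul_nonpos_of_nonneg_of_nonpos (hw _ _) (by have := hz y'; linarith)
    have h2 := hu y
    by_contra! h3
    have : κ y * u y < 0 := mul_neg_of_pos_of_neg h3 (by linarith)
    linarith
  rcases hpos z with h | ⟨y, hzy, hy⟩
  · exact absurd (key z rfl) (not_le.mpr h)
  · refine absurd (key y ?_) (not_le.mpr hy)
    have h0 : 0 ≤ ∑ y', w z y' * (u z - u y') := by
      have := hu z
      have := mul_nonpos_of_nonneg_of_nonpos (hκ z) hneg.le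
      linarith
    have hle : ∀ y' ∈ Finset.univ, w z y' * (u z - u y') ≤ 0 := fun y' _ =>
      mul_nonpos_of_nonneg_of_nonpos (hw _ _) (by have := hz y'; linarith)
    have h1 := (sum_eq_zero_iff_of_nonpos hle).mp (le_antisymm (sum_nonpos hle) h0) y (mem_univ y)
    have := (mul_eq_zero.mp h1).resolve_left hzy.ne'
    linarith

/-! ### The cutoff and the geometry of the grid -/

namespace RectFD

theorem cutoff_eq_max_min (f : ℝ → ℝ) {lam ρ K H : ℝ} (hlam : 0 < lam) (h : ρ ≤ K / H) (s : ℝ) :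
    cutoff f lam ρ K H s = max (ρ / lam) (min (f s) (K / (lam * H))) := by
  have h' : ρ / lam ≤ K / (lam * H) := by
    rw [mul_comm, ← div_div]
    gcongr
  unfold cutoff
  split_ifs with h1 h2
  · rw [min_eq_right h1.le, max_eq_right h']
  · rw [min_eq_left (not_lt.mp h1), max_eq_left h2.le]
  · rw [min_eq_left (not_lt.mp h1), max_eq_right (not_lt.mp h2)]

variable {N : ℕ}

theorem step_pos {a b : Fin N → ℝ} (hab : ∀ i, a i < b i) {m : Fin N → ℕ} (hm : ∀ i, 4 ≤ m i)
    (i : Fin N) : 0 < step a b m i := by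
  have : (4 : ℝ) ≤ m i := by exact_mod_cast hm i
  exact div_pos (by linarith [hab i]) (by linarith)

theorem gridPoint_eq_left_iff {a b : Fin N → ℝ} (hab : ∀ i, a i < b i) {m : Fin N → ℕ}
    (hm : ∀ i, 4 ≤ m i) (α : Fin N → ℤ) (i : Fin N) : gridPoint a b m α i = a i ↔ α i = 1 := by
  have h := step_pos hab hm i
  simp only [gridPoint, add_eq_left, mul_eq_zero, h.ne', or_false, sub_eq_zero]
  norm_cast

theorem gridPoint_eq_right_iff {a b : Fin N → ℝ} (hab : ∀ i, a i < b i) {m : Fin N → ℕ}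
    (hm : ∀ i, 4 ≤ m i) (α : Fin N → ℤ) (i : Fin N) :
    gridPoint a b m α i = b i ↔ α i = m i := by
  have h := step_pos hab hm i
  have hb : b i = a i + ((m i : ℝ) - 1) * step a b m i := by
    have : (4 : ℝ) ≤ m i := by exact_mod_cast hm i
    have : (m i : ℝ) - 1 ≠ 0 := by linarith
    simp only [step]; field_simp; ring
  conv_lhs => rhs; rw [hb]
  simp only [gridPoint, add_right_inj, mul_eq_mul_right_iff, h.ne', or_false, sub_left_inj]
  norm_cast

/-- The multi-indices of the nodes in the open rectangle. -/
def IsInterior (m : Fin N → ℕ) (α : Fin N → ℤ) : Prop :=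
  ∀ i, 1 < α i ∧ α i < (m i : ℤ)

/-- The `i`-th entry of the multi-index is extremal: the node lies on a face orthogonal to the
`i`-th axis. -/
def OnFace (m : Fin N → ℕ) (α : Fin N → ℤ) (i : Fin N) : Prop :=
  α i = 1 ∨ α i = (m i : ℤ)

theorem IsInterior.mem_indexSet {m : Fin N → ℕ} {α : Fin N → ℤ} (h : IsInterior m α) :
    α ∈ indexSet m := fun i => ⟨(h i).1.le, (h i).2.le⟩

theorem IsInterior.not_onFace {m : Fin N → ℕ} {α : Fin N → ℤ} (h : IsInterior m α) (i : Fin N) :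
    ¬ OnFace m α i := by
  have := h i
  rintro (h | h) <;> omega

theorem IsInterior.add_single_mem {m : Fin N → ℕ} {α : Fin N → ℤ} (h : IsInterior m α)
    (i : Fin N) : α + Pi.single i 1 ∈ indexSet m := by
  intro j
  have := h j
  by_cases hj : j = i
  · subst hj; simp; omega
  · simp [hj]; omega

theorem IsInterior.sub_single_mem {m : Fin N → ℕ} {α : Fin N → ℤ} (h : IsInterior m α)
    (i : Fin N) : α - Pi.single i 1 ∈ indexSet m := by
  intro j
  have := h j
  by_cases hj : j = i
  · subst hj; simp; omega
  · simp [hj]; omega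

theorem one_lt_and_lt_of_not_onFace {m : Fin N → ℕ} {α : Fin N → ℤ} (hα : α ∈ indexSet m)
    {j : Fin N} (h : ¬ OnFace m α j) : 1 < α j ∧ α j < (m j : ℤ) := by
  have := hα j
  simp only [OnFace, not_or] at h
  omega

/-- The neighbour in the inward normal direction of a node on a single, lower, face is interior. -/
theorem isInterior_add_single {m : Fin N → ℕ} (hm : ∀ i, 4 ≤ m i) {α : Fin N → ℤ}
    (hα : α ∈ indexSet m) {i : Fin N} (hi : α i = 1) (huniq : ∀ j, OnFace m α j → j = i) :
    IsInterior m (α + Pi.single i 1) := by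
  intro j
  have := hm j
  by_cases hj : j = i
  · subst hj; simp; omega
  · simpa [hj] using one_lt_and_lt_of_not_onFace hα fun h => hj (huniq j h)

/-- The neighbour in the inward normal direction of a node on a single, upper, face is interior. -/
theorem isInterior_sub_single {m : Fin N → ℕ} (hm : ∀ i, 4 ≤ m i) {α : Fin N → ℤ}
    (hα : α ∈ indexSet m) {i : Fin N} (hi : α i = m i) (huniq : ∀ j, OnFace m α j → j = i) :
    IsInterior m (α - Pi.single i 1) := by
  intro j
  have := hm j
  by_cases hj : j = i
  · subst hj; simp; omega
  · simpa [hj] using one_lt_and_lt_of_not_onFace hα fun h => hj (huniq j h)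

theorem isInterior_of_gridPoint_mem {a b : Fin N → ℝ} (hab : ∀ i, a i < b i) {m : Fin N → ℕ}
    (hm : ∀ i, 4 ≤ m i) {α : Fin N → ℤ} (hα : α ∈ indexSet m)
    (h : gridPoint a b m α ∈ domain a b) : IsInterior m α := by
  intro i
  have h1 : α i ≠ 1 := fun e => (h i).1.ne' ((gridPoint_eq_left_iff hab hm α i).mpr e)
  have h2 : α i ≠ m i := fun e => (h i).2.ne ((gridPoint_eq_right_iff hab hm α i).mpr e)
  have := hα i
  omega

theorem existsUnique_onFace_of_gridPoint_mem {a b : Fin N → ℝ} (hab : ∀ i, a i < b i)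
    {m : Fin N → ℕ} (hm : ∀ i, 4 ≤ m i) {α : Fin N → ℤ}
    (h : gridPoint a b m α ∈ smoothBoundary a b) : ∃! i, OnFace m α i := by
  simpa only [OnFace, gridPoint_eq_left_iff hab hm, gridPoint_eq_right_iff hab hm] using h.2

instance finite_indexSet (m : Fin N → ℕ) : Finite (indexSet m) := by
  have : indexSet m = Set.Icc 1 (fun i => (m i : ℤ)) := by
    ext α
    simp only [indexSet, Set.mem_ofPred_eq, Set.mem_Icc, Pi.le_def, Pi.one_apply, forall_and]
  rw [this]
  exact (Set.finite_Icc _ _).to_subtype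

/-! ### The scheme as a weighted graph -/

open Classical in
/-- The conductance between two nodes: `1 / hᵢ²` if they are neighbours in the direction `i` and at
least one of them is interior. Edges within the boundary do not occur in the scheme. -/
noncomputable def weight (a b : Fin N → ℝ) (m : Fin N → ℕ) (α β : Fin N → ℤ) : ℝ :=
  ∑ i, if (IsInterior m α ∨ IsInterior m β) then
    (if β = α + Pi.single i 1 then 1 / step a b m i ^ 2 else 0) +
      (if β = α - Pi.single i 1 then 1 / step a b m i ^ 2 else 0) else 0

theorem weight_comm (a b : Fin N → ℝ) (m : Fin N → ℕ) (α β : Fin N → ℤ) :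
    weight a b m α β = weight a b m β α := by
  refine Finset.sum_congr rfl fun i _ => ?_
  have h1 : β = α - Pi.single i 1 ↔ α = β + Pi.single i 1 := by rw [eq_sub_iff_add_eq, eq_comm]
  have h2 : β = α + Pi.single i 1 ↔ α = β - Pi.single i 1 := by rw [eq_sub_iff_add_eq, eq_comm]
  simp only [h1, h2, add_comm]
  classical exact if_congr or_comm rfl rfl

theorem weight_nonneg (a b : Fin N → ℝ) (m : Fin N → ℕ) (α β : Fin N → ℤ) :
    0 ≤ weight a b m α β := by
  refine Finset.sum_nonneg fun i _ => ?_
  split_ifs <;> positivity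

open Classical in
theorem sum_weight_mul (a b : Fin N → ℝ) (m : Fin N → ℕ) [Fintype (indexSet m)]
    (u : GridFunction m) (α : indexSet m) :
    ∑ β : indexSet m, weight a b m α β * (u α - u β) =
      ∑ i, ((if IsInterior m α ∨ IsInterior m (α.1 + Pi.single i 1) then
          (u.val α - u.val (α.1 + Pi.single i 1)) / step a b m i ^ 2 else 0) +
        (if IsInterior m α ∨ IsInterior m (α.1 - Pi.single i 1) then
          (u.val α - u.val (α.1 - Pi.single i 1)) / step a b m i ^ 2 else 0)) := by
  have hv : ∀ β : indexSet m, u β = u.val β := fun β => by simp [GridFunction.val]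
  have key : ∀ (γ : Fin N → ℤ) (k : ℝ), (IsInterior m α → γ ∈ indexSet m) →
      ∑ β : indexSet m, (if IsInterior m α ∨ IsInterior m β.1 then
        (if β.1 = γ then 1 / k else 0) else 0) * (u α - u β)
      = if IsInterior m α ∨ IsInterior m γ then (u.val α - u.val γ) / k else 0 := by
    intro γ k hγ
    split_ifs with h
    · have hmem : γ ∈ indexSet m := h.elim hγ IsInterior.mem_indexSet
      rw [Finset.sum_eq_single ⟨γ, hmem⟩]
      · simp only [h, if_true, hv]; ring
      · intro β _ hβ
        have : β.1 ≠ γ := fun e => hβ (Subtype.ext e)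
        simp [this]
      · simp
    · refine Finset.sum_eq_zero fun β _ => ?_
      by_cases hβ : β.1 = γ
      · rw [hβ, if_neg h, zero_mul]
      · simp [hβ]
  simp only [weight, Finset.sum_mul]
  rw [Finset.sum_comm]
  refine Finset.sum_congr rfl fun i _ => ?_
  rw [← key _ _ fun h => h.add_single_mem i, ← key _ _ fun h => h.sub_single_mem i,
    ← Finset.sum_add_distrib]
  refine Finset.sum_congr rfl fun β _ => ?_
  rw [← add_mul]
  split_ifs <;> simp

theorem sum_weight_mul_of_isInterior (a b : Fin N → ℝ) (m : Fin N → ℕ) [Fintype (indexSet m)]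
    (u : GridFunction m) (α : indexSet m) (hα : IsInterior m α) :
    ∑ β : indexSet m, weight a b m α β * (u α - u β) = -discreteLaplacian a b u α := by
  rw [sum_weight_mul, discreteLaplacian, ← Finset.sum_neg_distrib]
  refine Finset.sum_congr rfl fun i _ => ?_
  simp only [hα, true_or, if_true, secondDiff]
  ring

/-- On the smooth boundary the only interior neighbour is the one in the inward normal direction. -/
theorem sum_weight_mul_of_onFace {a b : Fin N → ℝ} (hab : ∀ i, a i < b i) {m : Fin N → ℕ}
    (hm : ∀ i, 4 ≤ m i) [Fintype (indexSet m)] (u : GridFunction m) (α : indexSet m) (i : Fin N)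
    (hi : OnFace m α i) (huniq : ∀ j, OnFace m α j → j = i) :
    ∑ β : indexSet m, weight a b m α β * (u α - u β) = normalDeriv a b u α / step a b m i := by
  classical
  have hnot : ¬ IsInterior m α := fun h => h.not_onFace i hi
  have hoff : ∀ j, j ≠ i → ¬ IsInterior m (α.1 + Pi.single j 1) ∧
      ¬ IsInterior m (α.1 - Pi.single j 1) := fun j hj =>
    ⟨fun h => h.not_onFace i (by simpa [OnFace, hj.symm] using hi),
      fun h => h.not_onFace i (by simpa [OnFace, hj.symm] using hi)⟩
  have hmi := hm i
  have hs := step_pos hab hm i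
  rw [sum_weight_mul, normalDeriv, Finset.sum_eq_single i, Finset.sum_eq_single i]
  · rcases hi with hi | hi
    · have hplus : IsInterior m (α.1 + Pi.single i 1) :=
        isInterior_add_single hm α.2 hi huniq
      have hminus : ¬ IsInterior m (α.1 - Pi.single i 1) := by
        intro h
        have := h i
        simp at this; omega
      have hn : outwardNormal a b (gridPoint a b m α) i = -1 := by
        simp [outwardNormal, (gridPoint_eq_left_iff hab hm α i).mpr hi]
      simp only [hnot, hplus, hminus, boundaryGradient, hn, forwardDiff]
      norm_num
      field_simp
      ring
    · have hminus : IsInterior m (α.1 - Pi.single i 1) :=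
        isInterior_sub_single hm α.2 hi huniq
      have hplus : ¬ IsInterior m (α.1 + Pi.single i 1) := by
        intro h
        have := h i
        simp at this; omega
      have hne : ¬ gridPoint a b m α i = a i := by
        rw [gridPoint_eq_left_iff hab hm]; omega
      have hn : outwardNormal a b (gridPoint a b m α) i = 1 := by
        rw [outwardNormal, if_neg hne, if_pos ((gridPoint_eq_right_iff hab hm α i).mpr hi)]
      simp only [hnot, hplus, hminus, boundaryGradient, hn, backwardDiff]
      norm_num
      field_simp
  · intro j _ hj
    have h := one_lt_and_lt_of_not_onFace α.2 fun h => hj (huniq j h)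
    have h1 : ¬ gridPoint a b m α j = a j := by rw [gridPoint_eq_left_iff hab hm]; omega
    have h2 : ¬ gridPoint a b m α j = b j := by rw [gridPoint_eq_right_iff hab hm]; omega
    simp [outwardNormal, h1, h2]
  · simp
  · intro j _ hj
    simp [hnot, hoff j hj]
  · simp

theorem exists_weight_pos_of_onFace {a b : Fin N → ℝ} (hab : ∀ i, a i < b i) {m : Fin N → ℕ}
    (hm : ∀ i, 4 ≤ m i) (α : indexSet m) (h : ∃! i, OnFace m α i) :
    ∃ β : indexSet m, 0 < weight a b m α β ∧ IsInterior m β := by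
  classical
  obtain ⟨i, hi, huniq⟩ := h
  have hs := step_pos hab hm i
  obtain ⟨β, hβ, hadj⟩ : ∃ β, IsInterior m β ∧
      (β = α.1 + Pi.single i 1 ∨ β = α.1 - Pi.single i 1) := by
    rcases hi with hi | hi
    · exact ⟨_, isInterior_add_single hm α.2 hi huniq, Or.inl rfl⟩
    · exact ⟨_, isInterior_sub_single hm α.2 hi huniq, Or.inr rfl⟩
  refine ⟨⟨β, hβ.mem_indexSet⟩, Finset.sum_pos' (fun j _ => ?_) ⟨i, Finset.mem_univ i, ?_⟩, hβ⟩
  · split_ifs <;> positivity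
  · simp only [hβ, or_true, if_true]
    rcases hadj with h | h
    · rw [if_pos h]; split_ifs <;> positivity
    · rw [if_pos h]; split_ifs <;> positivity

end RectFD

/-! ### Existence of a nonnegative solution of the scheme -/

theorem lemma2p1 (N : ℕ) (hN : 1 ≤ N)
    (a b : Fin N → ℝ) (hab : ∀ i, a i < b i)
    (m : Fin N → ℕ) (hm : ∀ i, 4 ≤ m i)
    (f : ℝ → ℝ) (hf_cont : ContinuousOn f (Set.Ici 0)) (hf_nonneg : ∀ s, 0 ≤ s → 0 ≤ f s)
    (lam : ℝ) (hlam : 0 < lam)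
    (ρ K : ℝ) (hρ : 0 < ρ) (hK : 0 < K) (hρK : ρ ≤ K / RectFD.maxStep a b m) :
    ∃ u : RectFD.GridFunction m, (∀ α, 0 ≤ u α) ∧
      RectFD.SolvesScheme a b m lam
        (RectFD.cutoff f lam ρ K (RectFD.maxStep a b m)) u := by
  classical
  set H := RectFD.maxStep a b m
  have := Fintype.ofFinite (RectFD.indexSet m)
  have hstep := RectFD.step_pos hab hm
  set g : ℝ → ℝ := fun s => RectFD.cutoff f lam ρ K H (max s 0) with hg
  have hgeq : g = fun s => max (ρ / lam) (min (f (max s 0)) (K / (lam * H))) :=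
    funext fun s => RectFD.cutoff_eq_max_min f hlam hρK _
  have hfc : Continuous fun s => f (max s 0) :=
    hf_cont.comp_continuous (by fun_prop) fun s => le_max_right s 0
  have hgc : Continuous g := by
    rw [hgeq]; exact continuous_const.max (hfc.min continuous_const)
  have hg0 : ∀ s, 0 ≤ g s := fun s => by
    rw [hgeq]; exact (div_pos hρ hlam).le.trans (le_max_left _ _)
  have hgM : ∀ s, |g s| ≤ max (ρ / lam) (K / (lam * H)) := fun s => by
    rw [abs_of_nonneg (hg0 s), hgeq]
    exact max_le_max le_rfl (min_le_right _ _)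
  -- At the boundary nodes outside the smooth part, where nothing is prescribed, `κ = 1` keeps the
  -- energy coercive.
  let κ : RectFD.indexSet m → ℝ := fun α => if ∃! i, RectFD.OnFace m α i then 0 else 1
  let c : RectFD.indexSet m → ℝ := fun α =>
    ∑ i, if RectFD.OnFace m α i then lam / RectFD.step a b m i else 0
  have hκ : ∀ α, 0 ≤ κ α := fun α => by simp only [κ]; split_ifs <;> simp
  have hκint : ∀ α : RectFD.indexSet m, RectFD.IsInterior m α → κ α = 1 := fun α hα =>
    if_neg fun ⟨i, hi, _⟩ => hα.not_onFace i hi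
  have hc : ∀ α, 0 ≤ c α := fun α => Finset.sum_nonneg fun i _ => by
    have := hstep i
    split_ifs <;> positivity
  have hw : ∀ α β : RectFD.indexSet m, 0 ≤ RectFD.weight a b m α β := fun α β =>
    RectFD.weight_nonneg a b m α β
  have hpos : ∀ α, 0 < κ α ∨ ∃ β : RectFD.indexSet m, 0 < RectFD.weight a b m α β ∧ 0 < κ β := by
    intro α
    by_cases h : ∃! i, RectFD.OnFace m α i
    · obtain ⟨β, hβ, hint⟩ := RectFD.exists_weight_pos_of_onFace hab hm α h
      exact Or.inr ⟨β, hβ, by rw [hκint β hint]; exact one_pos⟩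
    · exact Or.inl (by simp only [κ, if_neg h]; exact one_pos)
  obtain ⟨u, hu⟩ := WeightedGraph.exists_solution
    (fun α β : RectFD.indexSet m => RectFD.weight a b m α β) κ c
    (fun α β => RectFD.weight_comm a b m α β) hw hκ hpos g hgc _ hgM
  have hu0 : ∀ α, 0 ≤ u α := WeightedGraph.nonneg_of_supersolution _ κ hw hκ hpos u fun α => by
    rw [hu α]; exact mul_nonneg (hc α) (hg0 _)
  refine ⟨u, hu0, fun α hα hx => ?_, fun α hα hx => ?_⟩
  · have hint := RectFD.isInterior_of_gridPoint_mem hab hm hα hx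
    have h := hu ⟨α, hα⟩
    have hc0 : c ⟨α, hα⟩ = 0 := Finset.sum_eq_zero fun i _ => if_neg (hint.not_onFace i)
    rw [RectFD.sum_weight_mul_of_isInterior a b m u ⟨α, hα⟩ hint, hκint ⟨α, hα⟩ hint, hc0] at h
    simpa [RectFD.GridFunction.val, hα] using h
  · have hex := RectFD.existsUnique_onFace_of_gridPoint_mem hab hm hx
    have hκ0 : κ ⟨α, hα⟩ = 0 := if_pos hex
    obtain ⟨i, hi, huniq⟩ := hex
    have hci : c ⟨α, hα⟩ = lam / RectFD.step a b m i := by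
      simp only [c]
      rw [Finset.sum_eq_single i (fun j _ hj => if_neg fun h => hj (huniq j h)) (by simp),
        if_pos hi]
    have h := hu ⟨α, hα⟩
    rw [RectFD.sum_weight_mul_of_onFace hab hm u ⟨α, hα⟩ i hi huniq, hκ0, hci] at h
    have hval : RectFD.GridFunction.val u α = u ⟨α, hα⟩ := by simp [RectFD.GridFunction.val, hα]
    have hgu : RectFD.cutoff f lam ρ K H (u ⟨α, hα⟩) = g (u ⟨α, hα⟩) := by
      simp only [hg, max_eq_left (hu0 _)]
    have hs := (hstep i).ne'
    rw [hval, hgu]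
    field_simp at h
    linarith
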